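/- Let $n\ge 0$ be an integer, let $I\subseteq\mathbb R$ be an open interval and let $f:I\times\mathbb R^n\to\mathbb R^n$ be continuous and $C^3$ in $x$ (that is, $f(t,\cdot)$ is $C^3$ for every $t\in I$, and its derivatives with respect to $x$ up to order $3$ are continuous on $I\times\mathbb R^n$). For $(\tau,\xi)\in I\times\mathbb R^n$ let $\varphi(t,\tau,\xi)$, $t\in I(\tau,\xi)$, denote the maximal solution through $(\tau,\xi)$ of $$\frac{dx}{dt}=f(t,x),\qquad (t,x)\in I\times\mathbb R^n. \tag{1}$$ (a) The following are equivalent. 1. The system (1) is a vector Riccati equation: there are continuous functions $a,c:I\to\mathbb R^n$ and $B:I\to\mathbb R^{n\times n}$ with $f(t,x)=a(t)+B(t)x+(c(t)^{T}x)\,x$ for all $(t,x)\in I\times\mathbb R^n$. 2. The general solution of (1) is a fractional linear vector function of $\xi$: there are functions $A(t,\tau)\in\mathbb R^{n\times n}$, $\beta(t,\tau),\gamma(t,\tau)\in\mathbb R^n$, $\delta(t,\tau)\in\mathbb R$ of $t,\tau\in I$, with $(\gamma(t,\tau),\delta(t,\tau))\ne(0,0)$, such that for all $\tau\in I$, $\xi\in\mathbb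 R^n$ and $t\in I(\tau,\xi)$ one has $\gamma(t,\tau)^{T}\xi+\delta(t,\tau)\neq 0$ and $$\varphi(t,\tau,\xi)=\frac{A(t,\tau)\xi+\beta(t,\tau)}{\gamma(t,\tau)^{T}\xi+\delta(t,\tau)}. \tag{2}$$ (b) Suppose that $f(t,x)=a(t)+B(t)x+(c(t)^{T}x)\,x$ as in 1. Then the $(n+1)$-dimensional linear system $$\frac{d}{dt}\begin{bmatrix}y\\ z\end{bmatrix}=\begin{bmatrix}B(t)&a(t)\\ -c(t)^{T}&0\end{bmatrix}\begin{bmatrix}y\\ z\end{bmatrix},\qquad t\in I,$$ has a fundamental matrix $$\Phi(t,\tau)=\begin{bmatrix}A(t,\tau)&\beta(t,\tau)\\ \gamma(t,\tau)^{T}&\delta(t,\tau)\end{bmatrix},\quad t,\tau\in I,\qquad \Phi(\tau,\tau)=E_{n+1},$$ and with its blocks, for all $\tau\in I$ and $\xi\in\mathbb R^n$, the interval $I(\tau,\xi)$ is the maximal subinterval of $I$ that contains $\tau$ and on which $\gamma(t,\tau)^{T}\xi+\delta(t,\tau)\neq0$, and (2) holds for all $t\in I(\tau,\xi)$. -/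

import Mathlib

open Set Matrix

/-- `f` is continuous on `I × ℝⁿ` and `C³` in the state variable: for each `t ∈ I` the map `f t` is
`C³`, and its derivatives with respect to `x` of order `0, 1, 2, 3` are continuous functions of
`(t, x) ∈ I × ℝⁿ`. (Order `0` is the continuity of `f` itself.) -/
def IsC3InState {n : ℕ} (I : Set ℝ) (f : ℝ → (Fin n → ℝ) → (Fin n → ℝ)) : Prop :=
  (∀ t ∈ I, ContDiff ℝ 3 (f t)) ∧
    ∀ k : ℕ, k ≤ 3 →
      ContinuousOn (fun p : ℝ × (Fin n → ℝ) => iteratedFDeriv ℝ k (f p.1) p.2) (I ×ˢ univ)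

/-- `x`, restricted to the open interval `J ⊆ I`, is a solution of `dx/dt = f(t, x)` through the
point `(τ, ξ)`. -/
structure IsSolutionThrough {n : ℕ} (I : Set ℝ) (f : ℝ → (Fin n → ℝ) → (Fin n → ℝ))
    (τ : ℝ) (ξ : Fin n → ℝ) (J : Set ℝ) (x : ℝ → (Fin n → ℝ)) : Prop where
  isOpen : IsOpen J
  ordConnected : J.OrdConnected
  subset : J ⊆ I
  mem : τ ∈ J
  initial : x τ = ξ
  hasDerivAt : ∀ t ∈ J, HasDerivAt x (f t (x t)) t

/-- The interval `I(τ, ξ)` of the maximal solution through `(τ, ξ)`: the union of the open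
intervals on which there is a solution through `(τ, ξ)`. -/
def maximalInterval {n : ℕ} (I : Set ℝ) (f : ℝ → (Fin n → ℝ) → (Fin n → ℝ))
    (τ : ℝ) (ξ : Fin n → ℝ) : Set ℝ :=
  {t | ∃ (J : Set ℝ) (x : ℝ → (Fin n → ℝ)), IsSolutionThrough I f τ ξ J x ∧ t ∈ J}

open Classical in
/-- The general solution `φ(t, τ, ξ)`: for `t ∈ I(τ, ξ)`, the value at `t` of a solution through
`(τ, ξ)` whose interval contains `t` (all of them have the same value at `t` when initial value
problems have unique solutions). The value for `t ∉ I(τ, ξ)` is irrelevant. -/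
noncomputable def generalSolution {n : ℕ} (I : Set ℝ) (f : ℝ → (Fin n → ℝ) → (Fin n → ℝ))
    (t τ : ℝ) (ξ : Fin n → ℝ) : Fin n → ℝ :=
  if h : ∃ (x : ℝ → (Fin n → ℝ)) (J : Set ℝ), IsSolutionThrough I f τ ξ J x ∧ t ∈ J then
    h.choose t
  else 0

/-- On `I × ℝⁿ`, `f(t, x) = a(t) + B(t) x + (c(t)ᵀ x) x` with `a`, `B`, `c` continuous on `I`. -/
structure IsRiccatiWith {n : ℕ} (I : Set ℝ) (f : ℝ → (Fin n → ℝ) → (Fin n → ℝ))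
    (a : ℝ → (Fin n → ℝ)) (B : ℝ → Matrix (Fin n) (Fin n) ℝ) (c : ℝ → (Fin n → ℝ)) : Prop where
  continuousOn_a : ContinuousOn a I
  continuousOn_B : ContinuousOn B I
  continuousOn_c : ContinuousOn c I
  eq : ∀ t ∈ I, ∀ x, f t x = a t + B t *ᵥ x + (c t ⬝ᵥ x) • x

/-- The system `dx/dt = f(t, x)`, `(t, x) ∈ I × ℝⁿ`, is a vector Riccati equation. -/
def IsVectorRiccati {n : ℕ} (I : Set ℝ) (f : ℝ → (Fin n → ℝ) → (Fin n → ℝ)) : Prop :=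
  ∃ (a : ℝ → (Fin n → ℝ)) (B : ℝ → Matrix (Fin n) (Fin n) ℝ) (c : ℝ → (Fin n → ℝ)),
    IsRiccatiWith I f a B c

/-- The fractional linear vector function `x ↦ (A x + β) / (γᵀ x + δ)`
(meaningful where `γᵀ x + δ ≠ 0`). -/
noncomputable def fracLin {n : ℕ} (A : Matrix (Fin n) (Fin n) ℝ) (β γ : Fin n → ℝ) (δ : ℝ)
    (x : Fin n → ℝ) : Fin n → ℝ :=
  (γ ⬝ᵥ x + δ)⁻¹ • (A *ᵥ x + β)

/-- The general solution is a fractional linear vector function of the initial value `ξ`: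
`φ(t, τ, ξ) = (A(t, τ) ξ + β(t, τ)) / (γ(t, τ)ᵀ ξ + δ(t, τ))` for all `τ ∈ I`, `ξ ∈ ℝⁿ` and
`t ∈ I(τ, ξ)`, with `(γ, δ) ≠ 0` and with nonvanishing denominator. -/
def HasFracLinGeneralSolution {n : ℕ} (I : Set ℝ)
    (f : ℝ → (Fin n → ℝ) → (Fin n → ℝ)) : Prop :=
  ∃ (A : ℝ → ℝ → Matrix (Fin n) (Fin n) ℝ) (β γ : ℝ → ℝ → (Fin n → ℝ)) (δ : ℝ → ℝ → ℝ),
    (∀ t ∈ I, ∀ τ ∈ I, γ t τ ≠ 0 ∨ δ t τ ≠ 0) ∧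
    ∀ τ ∈ I, ∀ ξ, ∀ t ∈ maximalInterval I f τ ξ,
      γ t τ ⬝ᵥ ξ + δ t τ ≠ 0 ∧
      generalSolution I f t τ ξ = fracLin (A t τ) (β t τ) (γ t τ) (δ t τ) ξ

/-- The coefficient matrix `[[B(t), a(t)], [-c(t)ᵀ, 0]]` of the associated linear system in
dimension `n + 1`. -/
def linearizedMatrix {n : ℕ} (a : ℝ → (Fin n → ℝ)) (B : ℝ → Matrix (Fin n) (Fin n) ℝ)
    (c : ℝ → (Fin n → ℝ)) (t : ℝ) : Matrix (Fin n ⊕ Unit) (Fin n ⊕ Unit) ℝ :=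
  Matrix.fromBlocks (B t) (Matrix.replicateCol Unit (a t)) (-Matrix.replicateRow Unit (c t)) 0

/-- `Φ(t, τ)`, `t, τ ∈ I`, is the fundamental matrix of `dw/dt = M(t) w` with `Φ(τ, τ) = E`. -/
def IsFundamentalMatrix {m : Type*} [Fintype m] [DecidableEq m] (I : Set ℝ)
    (M : ℝ → Matrix m m ℝ) (Φ : ℝ → ℝ → Matrix m m ℝ) : Prop :=
  ∀ τ ∈ I, Φ τ τ = 1 ∧
    ∀ t ∈ I, ∀ i j, HasDerivAt (fun s => Φ s τ i j) ((M t * Φ t τ) i j) t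

/-- The block `A` (upper left) of `Φ = [[A, β], [γᵀ, δ]]`. -/
def blockA {n : ℕ} (Φ : Matrix (Fin n ⊕ Unit) (Fin n ⊕ Unit) ℝ) : Matrix (Fin n) (Fin n) ℝ :=
  Φ.toBlocks₁₁

/-- The column `β` (upper right) of `Φ = [[A, β], [γᵀ, δ]]`. -/
def blockBeta {n : ℕ} (Φ : Matrix (Fin n ⊕ Unit) (Fin n ⊕ Unit) ℝ) : Fin n → ℝ :=
  fun i => Φ (Sum.inl i) (Sum.inr ())

/-- The column `γ` (its transpose is the lower left row) of `Φ = [[A, β], [γᵀ, δ]]`. -/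
def blockGamma {n : ℕ} (Φ : Matrix (Fin n ⊕ Unit) (Fin n ⊕ Unit) ℝ) : Fin n → ℝ :=
  fun j => Φ (Sum.inr ()) (Sum.inl j)

/-- The scalar `δ` (lower right) of `Φ = [[A, β], [γᵀ, δ]]`. -/
def blockDelta {n : ℕ} (Φ : Matrix (Fin n ⊕ Unit) (Fin n ⊕ Unit) ℝ) : ℝ :=
  Φ (Sum.inr ()) (Sum.inr ())

/-! Riccati to fractional linear: the Riccati equation is a linear flow on $\mathbb R^{n+1}$ seen in
the affine chart $x = y/z$. Let $(N, D)$ be the solution of the linear system starting at $(\xi,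
1)$. Where $D \ne 0$, the quotient $N/D$ solves the Riccati equation (`hasDerivAt_inv_smul`).
Conversely, along any solution $x$ through $(\tau, \xi)$ the defect $N - Dx$ solves a homogeneous
linear equation and starts at $0$, so $N = Dx$; then $D' = -(c^T x) D$, and $D$ never vanishes
(`denominator_ne_zero`). Hence solutions live exactly as long as $D \ne 0$, which gives (b) and one
implication of (a).

Fractional linear to Riccati: the given coefficients have no regularity in $t$, so they cannot be
differentiated directly. After division by $\delta$ they are determined by the solutions starting at
$0$ and $\pm e_i$, and these are differentiable at $t = \tau$. Differentiating the cleared identity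
at $t = \tau$ then shows that $f(\tau, \cdot)$ is a Riccati field (`velocity_eq_of_fracLin`), with
coefficients that are explicit in the values of $f$ at $0$ and $\pm e_i$, hence continuous. -/

open Filter Topology NNReal

/-- The vector field `v` is Lipschitz in the state variable on every ball, uniformly for times in
compact subsets of `I`. -/
def LocallyUniformlyLipschitz {E : Type*} [NormedAddCommGroup E] (I : Set ℝ) (v : ℝ → E → E) :
    Prop :=
  ∀ K ⊆ I, IsCompact K → ∀ R : ℝ, ∃ L : ℝ≥0, ∀ t ∈ K,
    LipschitzOnWith L (v t) (Metric.closedBall 0 R)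

/-! ### Uniqueness, local existence, gluing and Grönwall for general equations -/

section General

variable {E : Type*} [NormedAddCommGroup E] [NormedSpace ℝ E]

/-- On the compact segment from $\tau$ to $t$ both curves stay in one ball, where a single Lipschitz
constant serves; the uniqueness theorem is then applied forwards or backwards in time. -/
theorem LocallyUniformlyLipschitz.eqOn {I J : Set ℝ} {v : ℝ → E → E}
    (hv : LocallyUniformlyLipschitz I v) (hJ : J.OrdConnected) (hJI : J ⊆ I) {x y : ℝ → E}
    (hx : ∀ t ∈ J, HasDerivAt x (v t (x t)) t) (hy : ∀ t ∈ J, HasDerivAt y (v t (y t)) t)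
    {τ : ℝ} (hτ : τ ∈ J) (h : x τ = y τ) : EqOn x y J := by
  intro t ht
  have hK : uIcc τ t ⊆ J := hJ.uIcc_subset hτ ht
  have hxc : ContinuousOn x (uIcc τ t) := HasDerivAt.continuousOn fun s hs => hx s (hK hs)
  have hyc : ContinuousOn y (uIcc τ t) := HasDerivAt.continuousOn fun s hs => hy s (hK hs)
  obtain ⟨R₁, hR₁⟩ := isCompact_uIcc.exists_bound_of_continuousOn hxc
  obtain ⟨R₂, hR₂⟩ := isCompact_uIcc.exists_bound_of_continuousOn hyc
  obtain ⟨L, hL⟩ := hv _ (hK.trans hJI) isCompact_uIcc (max R₁ R₂)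
  have hxR : ∀ s ∈ uIcc τ t, x s ∈ Metric.closedBall (0 : E) (max R₁ R₂) := fun s hs => by
    simpa using Or.inl (hR₁ s hs)
  have hyR : ∀ s ∈ uIcc τ t, y s ∈ Metric.closedBall (0 : E) (max R₁ R₂) := fun s hs => by
    simpa using Or.inr (hR₂ s hs)
  rcases le_total τ t with hle | hle
  · rw [uIcc_of_le hle] at *
    have hs := fun s (hs : s ∈ Ico τ t) => Ico_subset_Icc_self hs
    exact ODE_solution_unique_of_mem_Icc_right (s := fun _ => Metric.closedBall 0 (max R₁ R₂))
      (fun s h => hL s (hs s h)) hxc (fun s h => (hx s (hK (hs s h))).hasDerivWithinAt)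
      (fun s h => hxR s (hs s h)) hyc (fun s h => (hy s (hK (hs s h))).hasDerivWithinAt)
      (fun s h => hyR s (hs s h)) h ⟨hle, le_rfl⟩
  · rw [uIcc_of_ge hle] at *
    have hs := fun s (hs : s ∈ Ioc t τ) => Ioc_subset_Icc_self hs
    exact ODE_solution_unique_of_mem_Icc_left (s := fun _ => Metric.closedBall 0 (max R₁ R₂))
      (fun s h => hL s (hs s h)) hxc (fun s h => (hx s (hK (hs s h))).hasDerivWithinAt)
      (fun s h => hxR s (hs s h)) hyc (fun s h => (hy s (hK (hs s h))).hasDerivWithinAt)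
      (fun s h => hyR s (hs s h)) h ⟨le_rfl, hle⟩

/-- Local existence of solutions. -/
theorem LocallyUniformlyLipschitz.exists_solution [ProperSpace E] {I : Set ℝ}
    (hI : IsOpen I) {v : ℝ → E → E} (hv : LocallyUniformlyLipschitz I v)
    (hc : ContinuousOn (fun p : ℝ × E => v p.1 p.2) (I ×ˢ univ)) {τ : ℝ} (hτ : τ ∈ I) (ξ : E) :
    ∃ ε > 0, Ioo (τ - ε) (τ + ε) ⊆ I ∧ ∃ x : ℝ → E, x τ = ξ ∧
      ∀ t ∈ Ioo (τ - ε) (τ + ε), HasDerivAt x (v t (x t)) t := by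
  obtain ⟨r, hr, hrI⟩ := Metric.nhds_basis_closedBall.mem_iff.1 (hI.mem_nhds hτ)
  have hball : Metric.closedBall ξ 1 ⊆ Metric.closedBall (0 : E) (‖ξ‖ + 1) :=
    Metric.closedBall_subset_closedBall' (by simp [add_comm])
  obtain ⟨L, hL⟩ := hv _ hrI (isCompact_closedBall τ r) (‖ξ‖ + 1)
  obtain ⟨C, hC⟩ := ((isCompact_closedBall τ r).prod
    (isCompact_closedBall ξ 1)).exists_bound_of_continuousOn
      (hc.mono (prod_mono hrI (subset_univ _)))
  set C' : ℝ≥0 := (max C 0).toNNReal with hC'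
  have hCC : (C' : ℝ) = max C 0 := Real.coe_toNNReal _ (le_max_right _ _)
  -- The speed is at most `C'` on the unit ball about `ξ`, so within time `ε` the displacement is
  -- below $1$; the summand $1$ avoids division by zero.
  set ε : ℝ := min r (1 / (C' + 1)) with hε
  have hC0 : (0 : ℝ) < C' + 1 := by positivity
  have hε0 : 0 < ε := lt_min hr (by positivity)
  have hsub : Icc (τ - ε) (τ + ε) ⊆ Metric.closedBall τ r := by
    rw [← Real.closedBall_eq_Icc]
    exact Metric.closedBall_subset_closedBall (min_le_left _ _)
  have hτ' : τ ∈ Icc (τ - ε) (τ + ε) := ⟨by linarith, by linarith⟩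
  have hPL : IsPicardLindelof v (⟨τ, hτ'⟩ : Icc (τ - ε) (τ + ε)) ξ 1 0 C' L :=
    { lipschitzOnWith := fun t ht => (hL t (hsub ht)).mono hball
      continuousOn := fun x _ => hc.comp (f := fun t : ℝ => (t, x)) (by fun_prop) fun t ht => ⟨hrI (hsub ht), mem_univ _⟩
      norm_le := fun t ht x hx => by
        rw [hCC]
        exact (hC (t, x) ⟨hsub ht, hx⟩).trans (le_max_left _ _)
      mul_max_le := by
        have h1 : ε ≤ 1 / (C' + 1) := min_le_right _ _
        rw [le_div_iff₀ hC0] at h1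
        simp only [add_sub_cancel_left, sub_sub_cancel, max_self, NNReal.coe_one,
          NNReal.coe_zero, sub_zero]
        nlinarith }
  obtain ⟨x, hx0, hx⟩ := hPL.exists_eq_forall_mem_Icc_hasDerivWithinAt₀
  refine ⟨ε, hε0, (Ioo_subset_Icc_self.trans hsub).trans hrI, x, hx0, fun t ht => ?_⟩
  exact (hx t (Ioo_subset_Icc_self ht)).hasDerivAt (Icc_mem_nhds ht.1 ht.2)

/-- Solutions of an initial value problem on open subintervals that cover `I` glue to a solution
on `I`. -/
theorem LocallyUniformlyLipschitz.exists_glued_solution {I : Set ℝ} {v : ℝ → E → E}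
    (hv : LocallyUniformlyLipschitz I v) {τ : ℝ} {ξ : E} (hτ : τ ∈ I)
    (h : ∀ t ∈ I, ∃ J ⊆ I, IsOpen J ∧ J.OrdConnected ∧ τ ∈ J ∧ t ∈ J ∧
      ∃ x : ℝ → E, x τ = ξ ∧ ∀ s ∈ J, HasDerivAt x (v s (x s)) s) :
    ∃ x : ℝ → E, x τ = ξ ∧ ∀ t ∈ I, HasDerivAt x (v t (x t)) t := by
  classical
  choose! J hJI hJo hJc hτJ htJ x hx0 hx using h
  -- By uniqueness the diagonal `s ↦ x s s` agrees with `x t` on the neighbourhood `J t` of `t`, so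
  -- it inherits the derivative there.
  have key : ∀ t ∈ I, ∀ s ∈ J t, x s s = x t s := fun t ht s hs => by
    have hsI := hJI t ht hs
    exact hv.eqOn ((hJc s hsI).inter (hJc t ht)) (inter_subset_left.trans (hJI s hsI))
      (fun r hr => hx s hsI r hr.1) (fun r hr => hx t ht r hr.2) ⟨hτJ s hsI, hτJ t ht⟩
      ((hx0 s hsI).trans (hx0 t ht).symm) ⟨htJ s hsI, hs⟩
  refine ⟨fun t => x t t, hx0 τ hτ, fun t ht => ?_⟩
  exact (hx t ht t (htJ t ht)).congr_of_eventuallyEq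
    (eventually_of_mem ((hJo t ht).mem_nhds (htJ t ht)) (key t ht))

theorem locallyUniformlyLipschitz_clm {I : Set ℝ} {A : ℝ → E →L[ℝ] E} (hA : ContinuousOn A I) :
    LocallyUniformlyLipschitz I (fun t x => A t x) := by
  intro K hK hKc R
  obtain ⟨C, hC⟩ := hKc.exists_bound_of_continuousOn (hA.mono hK)
  refine ⟨C.toNNReal, fun t ht => ((A t).lipschitz.weaken ?_).lipschitzOnWith⟩
  rw [← NNReal.coe_le_coe]
  exact (hC t ht).trans (Real.le_coe_toNNReal C)

/-- A solution of a homogeneous linear equation that vanishes somewhere vanishes identically. -/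
theorem eqOn_zero_of_linear {J : Set ℝ} (hJ : J.OrdConnected) {A : ℝ → E →L[ℝ] E}
    (hA : ContinuousOn A J) {x : ℝ → E} (hx : ∀ t ∈ J, HasDerivAt x (A t (x t)) t)
    {τ : ℝ} (hτ : τ ∈ J) (h : x τ = 0) : ∀ t ∈ J, x t = 0 :=
  (locallyUniformlyLipschitz_clm hA).eqOn hJ subset_rfl hx (y := fun _ => 0)
    (fun t _ => by simpa using hasDerivAt_const t (0 : E)) hτ h

/-- Two-sided Grönwall bound. -/
theorem norm_le_of_norm_deriv_le {x x' : ℝ → E} {a b K τ : ℝ} (hK : 0 ≤ K)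
    (hx : ∀ t ∈ Icc a b, HasDerivWithinAt x (x' t) (Icc a b) t)
    (hb : ∀ t ∈ Icc a b, ‖x' t‖ ≤ K * ‖x t‖) (hτ : τ ∈ Icc a b) :
    ∀ t ∈ Icc a b, ‖x t‖ ≤ ‖x τ‖ * Real.exp (K * (b - a)) := by
  intro t ht
  have hc : ContinuousOn x (Icc a b) := fun s hs => (hx s hs).continuousWithinAt
  rcases le_total τ t with hle | hle
  · have hs : Icc τ b ⊆ Icc a b := Icc_subset_Icc_left hτ.1
    have := norm_le_gronwallBound_of_norm_deriv_right_le (ε := 0) (hc.mono hs)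
      (fun s h => ((hx s (hs (Ico_subset_Icc_self h))).mono_of_mem_nhdsWithin
        (mem_of_superset (Icc_mem_nhdsGE h.2) (Icc_subset_Icc_left (hτ.1.trans h.1)))))
      le_rfl (fun s h => by simpa using hb s (hs (Ico_subset_Icc_self h))) t ⟨hle, ht.2⟩
    rw [gronwallBound_ε0] at this
    refine this.trans ?_
    gcongr
    · exact ht.2
    · exact hτ.1
  -- Times before `τ` are reduced to the forward Grönwall inequality by the reflection `s ↦ -s`.
  · have hs : MapsTo (fun s : ℝ => -s) (Icc (-τ) (-a)) (Icc a b) := fun s h =>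
      ⟨by linarith [h.2], by linarith [h.1, hτ.2]⟩
    have := norm_le_gronwallBound_of_norm_deriv_right_le (ε := 0) (K := K)
      (f := fun s => x (-s)) (f' := fun s => -x' (-s)) (a := -τ) (b := -a)
      (hc.comp continuousOn_neg hs)
      (fun s h => by
        have h1 : HasDerivWithinAt x (x' (-s)) (Iic (-s)) (-s) :=
          (hx _ (hs (Ico_subset_Icc_self h))).mono_of_mem_nhdsWithin
            (mem_of_superset (Icc_mem_nhdsLE (by linarith [h.2] : a < -s))
              (Icc_subset_Icc_right (by linarith [h.1, hτ.2])))
        have := h1.scomp s (hasDerivAt_neg s).hasDerivWithinAt (s := Ici s)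
          (fun r (hr : s ≤ r) => (neg_le_neg hr : -r ≤ -s))
        simpa [Function.comp_def] using this)
      le_rfl (fun s h => by simpa using hb _ (hs (Ico_subset_Icc_self h))) (-t)
      ⟨by linarith, by linarith [ht.1]⟩
    rw [gronwallBound_ε0] at this
    simp only [neg_neg] at this
    refine this.trans ?_
    have hle' : -t - -τ ≤ b - a := by linarith [ht.1, hτ.2]
    exact mul_le_mul_of_nonneg_left (Real.exp_le_exp.2 (mul_le_mul_of_nonneg_left hle' hK))
      (norm_nonneg _)

end General

/-! ### Global existence for linear equations -/

section Linear

variable {ι : Type*} [Fintype ι]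

/-- Coordinatewise truncation to `[-R, R]`. -/
def clampBox (R : ℝ) (x : ι → ℝ) : ι → ℝ := fun i => max (-R) (min R (x i))

theorem lipschitzWith_clampBox (R : ℝ) : LipschitzWith 1 (clampBox R : (ι → ℝ) → ι → ℝ) := by
  refine LipschitzWith.of_dist_le_mul fun x y => ?_
  rw [NNReal.coe_one, one_mul, dist_pi_le_iff dist_nonneg]
  intro i
  refine le_trans ?_ (dist_le_pi_dist x y i)
  simp only [clampBox, Real.dist_eq]
  grind

theorem norm_clampBox_le (R : ℝ) (hR : 0 ≤ R) (x : ι → ℝ) : ‖clampBox R x‖ ≤ ‖x‖ := by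
  have := (lipschitzWith_clampBox R).dist_le_mul x 0
  have h0 : clampBox R (0 : ι → ℝ) = 0 := by ext i; simp [clampBox, hR]
  simpa [h0] using this

theorem norm_clampBox_le_radius (R : ℝ) (hR : 0 ≤ R) (x : ι → ℝ) : ‖clampBox R x‖ ≤ R := by
  rw [pi_norm_le_iff_of_nonneg hR]
  intro i
  simp only [clampBox, Real.norm_eq_abs]
  grind

theorem clampBox_of_norm_le {R : ℝ} {x : ι → ℝ} (hx : ‖x‖ ≤ R) : clampBox R x = x := by
  ext i
  have := (norm_le_pi_norm x i).trans hx
  rw [Real.norm_eq_abs] at this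
  simp only [clampBox]
  grind

/-- The field truncated at radius `R` has norm at most `C * R` everywhere, so Picard–Lindelöf
applies on the whole interval at once. Truncation does not increase the norm, so Grönwall bounds the
solution by `R`, and the truncation was never active. -/
theorem exists_linear_solution_Icc {a b : ℝ} {A : ℝ → (ι → ℝ) →L[ℝ] (ι → ℝ)}
    (hA : ContinuousOn A (Icc a b)) {τ : ℝ} (hτ : τ ∈ Icc a b) (ξ : ι → ℝ) :
    ∃ x : ℝ → ι → ℝ, x τ = ξ ∧ ∀ t ∈ Icc a b, HasDerivWithinAt x (A t (x t)) (Icc a b) t := by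
  obtain ⟨C₀, hC₀⟩ := isCompact_Icc.exists_bound_of_continuousOn hA
  set C : ℝ≥0 := C₀.toNNReal
  have hC : ∀ t ∈ Icc a b, ‖A t‖ ≤ C := fun t ht => (hC₀ t ht).trans (Real.le_coe_toNNReal _)
  have hab : 0 ≤ b - a := sub_nonneg.2 (hτ.1.trans hτ.2)
  set R : ℝ := ‖ξ‖ * Real.exp (C * (b - a))
  have hR : 0 ≤ R := by positivity
  have hPL : IsPicardLindelof (fun t x => A t (clampBox R x)) (⟨τ, hτ⟩ : Icc a b) ξ
      (C * R.toNNReal * (b - a).toNNReal) 0 (C * R.toNNReal) C :=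
    { lipschitzOnWith := fun t ht => by
        have h := ((A t).lipschitz.comp (lipschitzWith_clampBox R)).weaken
          (K' := C) (by rw [mul_one, ← NNReal.coe_le_coe]; exact hC t ht)
        exact h.lipschitzOnWith
      continuousOn := fun x _ => hA.clm_apply continuousOn_const
      norm_le := fun t ht x _ => by
        refine ((A t).le_opNorm _).trans ?_
        rw [NNReal.coe_mul, Real.coe_toNNReal R hR]
        exact mul_le_mul (hC t ht) (norm_clampBox_le_radius R hR x) (norm_nonneg _) C.2
      mul_max_le := by
        rw [NNReal.coe_zero, sub_zero, NNReal.coe_mul (_ * _), Real.coe_toNNReal (b - a) hab]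
        gcongr
        exact max_le (by linarith [hτ.1]) (by linarith [hτ.2]) }
  obtain ⟨x, hx0, hx⟩ := hPL.exists_eq_forall_mem_Icc_hasDerivWithinAt₀
  have hbd := norm_le_of_norm_deriv_le C.2 hx (fun t ht => ((A t).le_opNorm _).trans
    (mul_le_mul (hC t ht) (norm_clampBox_le R hR _) (norm_nonneg _) C.2)) hτ
  refine ⟨x, hx0, fun t ht => ?_⟩
  have h := hx t ht
  have hxR := hbd t ht
  simp only at hx0
  rw [hx0] at hxR
  rwa [clampBox_of_norm_le (R := R) hxR] at h

/-- Solutions of a linear equation exist on the whole interval of continuity of the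
coefficients. -/
theorem exists_linear_solution {I : Set ℝ} (hIo : IsOpen I) (hI : I.OrdConnected)
    {A : ℝ → (ι → ℝ) →L[ℝ] (ι → ℝ)} (hA : ContinuousOn A I) {τ : ℝ} (hτ : τ ∈ I) (ξ : ι → ℝ) :
    ∃ x : ℝ → ι → ℝ, x τ = ξ ∧ ∀ t ∈ I, HasDerivAt x (A t (x t)) t := by
  refine (locallyUniformlyLipschitz_clm hA).exists_glued_solution hτ fun t ht => ?_
  have hmin : min τ t ∈ I := by rcases min_choice τ t with h | h <;> rwa [h]
  have hmax : max τ t ∈ I := by rcases max_choice τ t with h | h <;> rwa [h]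
  obtain ⟨a, ha, haI⟩ := mem_nhdsLE_iff_exists_Icc_subset.1
    (mem_nhdsWithin_of_mem_nhds (hIo.mem_nhds hmin))
  obtain ⟨b, hb, hbI⟩ := mem_nhdsGE_iff_exists_Icc_subset.1
    (mem_nhdsWithin_of_mem_nhds (hIo.mem_nhds hmax))
  have ha' : a < min τ t := ha
  have hb' : max τ t < b := hb
  have hτab : τ ∈ Ioo a b := by grind
  have htab : t ∈ Ioo a b := by grind
  have hsub : Icc a b ⊆ I := hI.out (haI ⟨le_rfl, ha'.le⟩) (hbI ⟨hb'.le, le_rfl⟩)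
  obtain ⟨x, hx0, hx⟩ := exists_linear_solution_Icc (hA.mono hsub) (Ioo_subset_Icc_self hτab) ξ
  exact ⟨Ioo a b, Ioo_subset_Icc_self.trans hsub, isOpen_Ioo, ordConnected_Ioo, hτab, htab, x,
    hx0, fun s hs => (hx s (Ioo_subset_Icc_self hs)).hasDerivAt (Icc_mem_nhds hs.1 hs.2)⟩

end Linear

/-! ### The maximal interval and the general solution -/

section StateSpace

variable {n : ℕ} {I : Set ℝ} {f : ℝ → (Fin n → ℝ) → (Fin n → ℝ)}

theorem IsC3InState.continuousOn (hf : IsC3InState I f) :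
    ContinuousOn (fun p : ℝ × (Fin n → ℝ) => f p.1 p.2) (I ×ˢ univ) := by
  have h := hf.2 0 (by norm_num)
  have h' := (continuousMultilinearCurryFin0 ℝ (Fin n → ℝ)
    (Fin n → ℝ)).continuous.comp_continuousOn h
  simpa [Function.comp_def] using h'

theorem IsC3InState.locallyUniformlyLipschitz (hf : IsC3InState I f) :
    LocallyUniformlyLipschitz I f := by
  intro K hK hKc R
  obtain ⟨C, hC⟩ := (hKc.prod (isCompact_closedBall (0 : Fin n → ℝ) R)).exists_bound_of_continuousOn
    ((hf.2 1 (by norm_num)).mono (prod_mono hK (subset_univ _)))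
  refine ⟨C.toNNReal, fun t ht => ?_⟩
  refine (convex_closedBall (0 : Fin n → ℝ) R).lipschitzOnWith_of_nnnorm_fderiv_le (𝕜 := ℝ)
    (fun x _ => ((hf.1 t (hK ht)).differentiable (by norm_num)).differentiableAt)
    fun x hx => ?_
  have := hC (t, x) ⟨ht, hx⟩
  rw [norm_iteratedFDeriv_one] at this
  rw [← NNReal.coe_le_coe]
  exact this.trans (Real.le_coe_toNNReal C)

theorem IsSolutionThrough.subset_maximalInterval {τ : ℝ} {ξ : Fin n → ℝ} {J : Set ℝ}
    {x : ℝ → Fin n → ℝ} (h : IsSolutionThrough I f τ ξ J x) : J ⊆ maximalInterval I f τ ξ :=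
  fun _ ht => ⟨J, x, h, ht⟩

theorem IsSolutionThrough.generalSolution_eq (hf : LocallyUniformlyLipschitz I f) {τ : ℝ}
    {ξ : Fin n → ℝ} {J : Set ℝ} {x : ℝ → Fin n → ℝ} (h : IsSolutionThrough I f τ ξ J x) {t : ℝ}
    (ht : t ∈ J) : generalSolution I f t τ ξ = x t := by
  have hex : ∃ (x : ℝ → Fin n → ℝ) (J : Set ℝ), IsSolutionThrough I f τ ξ J x ∧ t ∈ J :=
    ⟨x, J, h, ht⟩
  rw [generalSolution, dif_pos hex]
  obtain ⟨J', hJ', htJ'⟩ := hex.choose_spec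
  exact hf.eqOn (hJ'.ordConnected.inter h.ordConnected) (inter_subset_left.trans hJ'.subset)
    (fun s hs => hJ'.hasDerivAt s hs.1) (fun s hs => h.hasDerivAt s hs.2) ⟨hJ'.mem, h.mem⟩
    (hJ'.initial.trans h.initial.symm) ⟨htJ', ht⟩

theorem IsC3InState.exists_isSolutionThrough (hI : IsOpen I) (hf : IsC3InState I f) {τ : ℝ}
    (hτ : τ ∈ I) (ξ : Fin n → ℝ) : ∃ J x, IsSolutionThrough I f τ ξ J x := by
  obtain ⟨ε, hε, hsub, x, hx0, hx⟩ :=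
    hf.locallyUniformlyLipschitz.exists_solution hI hf.continuousOn hτ ξ
  exact ⟨_, x, isOpen_Ioo, ordConnected_Ioo, hsub, ⟨by linarith, by linarith⟩, hx0, hx⟩

/-- Recovers $f(\tau, \xi)$ as the initial velocity of the general solution, which is how
information on $\varphi$ is turned into information on $f$. -/
theorem IsC3InState.hasDerivAt_generalSolution (hI : IsOpen I) (hf : IsC3InState I f) {τ : ℝ}
    (hτ : τ ∈ I) (ξ : Fin n → ℝ) :
    generalSolution I f τ τ ξ = ξ ∧ (∀ᶠ t in 𝓝 τ, t ∈ maximalInterval I f τ ξ) ∧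
      HasDerivAt (fun t => generalSolution I f t τ ξ) (f τ ξ) τ := by
  obtain ⟨J, x, h⟩ := hf.exists_isSolutionThrough hI hτ ξ
  have hJ := h.isOpen.mem_nhds h.mem
  have heq := fun t (ht : t ∈ J) => h.generalSolution_eq hf.locallyUniformlyLipschitz ht
  refine ⟨(heq τ h.mem).trans h.initial, eventually_of_mem hJ h.subset_maximalInterval, ?_⟩
  have := h.hasDerivAt τ h.mem
  rw [h.initial] at this
  exact this.congr_of_eventuallyEq (eventually_of_mem hJ heq)

end StateSpace

/-! ### A fractional linear general solution forces a Riccati field -/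

section FractionalLinear

variable {n : ℕ} {I : Set ℝ} {f : ℝ → (Fin n → ℝ) → (Fin n → ℝ)}

/-- Dehomogenized and cleared form of `y = (A ξ + β) / (γᵀ ξ + δ)`, in coordinates. -/
theorem fracLin_mul_eq {A : Matrix (Fin n) (Fin n) ℝ} {β γ ξ : Fin n → ℝ} {δ : ℝ} (hδ : δ ≠ 0)
    (h : γ ⬝ᵥ ξ + δ ≠ 0) (k : Fin n) :
    (1 + ∑ i, ξ i * (γ i / δ)) * fracLin A β γ δ ξ k =
      (∑ i, ξ i * (A k i / δ)) + β k / δ := by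
  have h1 : (1 + ∑ i, ξ i * (γ i / δ)) = (γ ⬝ᵥ ξ + δ) / δ := by
    rw [dotProduct, add_div, div_self hδ, Finset.sum_div, add_comm]
    congr 1
    exact Finset.sum_congr rfl fun i _ => by ring
  have h2 : (∑ i, ξ i * (A k i / δ)) = (A *ᵥ ξ) k / δ := by
    rw [mulVec, dotProduct, Finset.sum_div]
    exact Finset.sum_congr rfl fun i _ => by ring
  rw [h1, h2, fracLin, Pi.smul_apply, Pi.add_apply, smul_eq_mul]
  field_simp

/-- If a family `g ξ` of curves with `g ξ τ = ξ` is fractional linear in `ξ`, then its velocity at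
`τ` is a Riccati vector field, with explicit coefficients. -/
theorem velocity_eq_of_fracLin {τ : ℝ} {g : (Fin n → ℝ) → ℝ → Fin n → ℝ}
    {v : (Fin n → ℝ) → Fin n → ℝ} {A : ℝ → Matrix (Fin n) (Fin n) ℝ} {β γ : ℝ → Fin n → ℝ}
    {δ : ℝ → ℝ} (h0 : ∀ ξ, g ξ τ = ξ) (hg : ∀ ξ, HasDerivAt (g ξ) (v ξ) τ)
    (hfrac : ∀ ξ, ∀ᶠ t in 𝓝 τ, γ t ⬝ᵥ ξ + δ t ≠ 0 ∧
      g ξ t = fracLin (A t) (β t) (γ t) (δ t) ξ)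
    {c : Fin n → ℝ}
    (hc : ∀ i, c i = (v (Pi.single i 1) i + v (-Pi.single i 1) i - 2 * v 0 i) / 2)
    (ξ : Fin n → ℝ) (k : Fin n) :
    v ξ k = v 0 k + (∑ i, ξ i * (v (Pi.single i 1) k - v 0 k - c i * (Pi.single i 1 : Fin n → ℝ) k))
      + (c ⬝ᵥ ξ) * ξ k := by
  have hgk : ∀ ξ k, HasDerivAt (fun t => g ξ t k) (v ξ k) τ := fun ξ =>
    hasDerivAt_pi.1 (hg ξ)
  -- At `ξ = 0` the denominator is `δ t` itself.
  have hδ : ∀ᶠ t in 𝓝 τ, δ t ≠ 0 := (hfrac 0).mono fun t ht => by simpa using ht.1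
  -- the cleared identity
  have hcl : ∀ ξ k, ∀ᶠ t in 𝓝 τ, (1 + ∑ i, ξ i * (γ t i / δ t)) * g ξ t k =
      (∑ i, ξ i * (A t k i / δ t)) + β t k / δ t := fun ξ k => by
    filter_upwards [hδ, hfrac ξ] with t h1 h2
    rw [h2.2]
    exact fracLin_mul_eq h1 h2.1 k
  have hβ : ∀ k, ∀ᶠ t in 𝓝 τ, β t k / δ t = g 0 t k := fun k =>
    (hcl 0 k).mono fun t ht => by simpa using ht.symm
  have hplus : ∀ i k, ∀ᶠ t in 𝓝 τ, (1 + γ t i / δ t) * g (Pi.single i 1) t k =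
      A t k i / δ t + g 0 t k := fun i k => by
    filter_upwards [hcl (Pi.single i 1) k, hβ k] with t ht h2
    simpa [Pi.single_apply, h2] using ht
  have hminus : ∀ i k, ∀ᶠ t in 𝓝 τ, (1 - γ t i / δ t) * g (-Pi.single i 1) t k =
      -(A t k i / δ t) + g 0 t k := fun i k => by
    filter_upwards [hcl (-Pi.single i 1) k, hβ k] with t ht h2
    simpa [Pi.single_apply, h2, sub_eq_add_neg] using ht
  -- Adding `hplus i i` and `hminus i i` eliminates `A t i i / δ t` and expresses `γ t i / δ t` as a
  -- quotient of differentiable functions, with numerator $0$ and denominator $2$ at `τ`.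
  have hdiff : ∀ i, HasDerivAt (fun t => γ t i / δ t) (-c i) τ ∧ γ τ i / δ τ = 0 := by
    intro i
    have hden : HasDerivAt (fun t => g (Pi.single i 1) t i - g (-Pi.single i 1) t i)
        (v (Pi.single i 1) i - v (-Pi.single i 1) i) τ := (hgk _ i).sub (hgk _ i)
    have hnum : HasDerivAt
        (fun t => 2 * g 0 t i - (g (Pi.single i 1) t i + g (-Pi.single i 1) t i))
        (2 * v 0 i - (v (Pi.single i 1) i + v (-Pi.single i 1) i)) τ :=
      ((hgk 0 i).const_mul 2).sub ((hgk _ i).add (hgk _ i))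
    have hden2 : g (Pi.single i 1) τ i - g (-Pi.single i 1) τ i = 2 := by
      rw [h0, h0]; simp; norm_num
    have hnum2 : 2 * g 0 τ i - (g (Pi.single i 1) τ i + g (-Pi.single i 1) τ i) = 0 := by
      rw [h0, h0, h0]; simp
    have hne : ∀ᶠ t in 𝓝 τ, g (Pi.single i 1) t i - g (-Pi.single i 1) t i ≠ 0 :=
      hden.continuousAt.eventually_ne (by rw [hden2]; norm_num)
    have heq : (fun t => γ t i / δ t) =ᶠ[𝓝 τ] fun t =>
        (2 * g 0 t i - (g (Pi.single i 1) t i + g (-Pi.single i 1) t i)) /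
          (g (Pi.single i 1) t i - g (-Pi.single i 1) t i) := by
      filter_upwards [hne, hplus i i, hminus i i] with t h1 h2 h3
      rw [eq_div_iff h1]
      linear_combination h2 + h3
    refine ⟨?_, by rw [heq.eq_of_nhds, hnum2, zero_div]⟩
    refine HasDerivAt.congr_of_eventuallyEq ?_ heq
    refine (hnum.fun_div hden (by rw [hden2]; norm_num)).congr_deriv ?_
    rw [hden2, hnum2, hc]
    ring
  have hlhs : HasDerivAt (fun t => (1 + ∑ i, ξ i * (γ t i / δ t)) * g ξ t k)
      ((∑ i, ξ i * -c i) * ξ k + v ξ k) τ := by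
    have h1 : HasDerivAt (fun t => 1 + ∑ i, ξ i * (γ t i / δ t)) (∑ i, ξ i * -c i) τ :=
      (HasDerivAt.fun_sum fun i _ => (hdiff i).1.const_mul (ξ i)).const_add 1
    have h2 := h1.fun_mul (hgk ξ k)
    simpa [(hdiff _).2, h0] using h2
  -- Here `A t k i / δ t` is replaced by its expression from `hplus`, so that only functions known
  -- to be differentiable remain.
  have hrhs : HasDerivAt
      (fun t => (∑ i, ξ i * ((1 + γ t i / δ t) * g (Pi.single i 1) t k - g 0 t k)) + g 0 t k)
      ((∑ i, ξ i * ((-c i * (Pi.single i 1 : Fin n → ℝ) k + v (Pi.single i 1) k) - v 0 k))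
        + v 0 k) τ := by
    refine (HasDerivAt.fun_sum fun i _ => ?_).add (hgk 0 k)
    have h2 := ((hdiff i).1.const_add 1).fun_mul (hgk (Pi.single i 1) k)
    simp only [(hdiff i).2, h0, add_zero, one_mul] at h2
    exact (h2.sub (hgk 0 k)).const_mul (ξ i)
  have heq : (fun t => (1 + ∑ i, ξ i * (γ t i / δ t)) * g ξ t k) =ᶠ[𝓝 τ]
      fun t => (∑ i, ξ i * ((1 + γ t i / δ t) * g (Pi.single i 1) t k - g 0 t k)) + g 0 t k := by
    filter_upwards [hcl ξ k, hβ k, eventually_all.2 fun i => hplus i k] with t h1 h2 h3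
    rw [h1, h2]
    congr 1
    exact Finset.sum_congr rfl fun i _ => by rw [h3]; ring
  have key := hlhs.unique (hrhs.congr_of_eventuallyEq heq)
  have e1 : (∑ i, ξ i * -c i) = -(c ⬝ᵥ ξ) := by
    rw [dotProduct, ← Finset.sum_neg_distrib]
    exact Finset.sum_congr rfl fun i _ => by ring
  have e2 : (∑ i, ξ i * ((-c i * (Pi.single i 1 : Fin n → ℝ) k + v (Pi.single i 1) k) - v 0 k)) =
      ∑ i, ξ i * (v (Pi.single i 1) k - v 0 k - c i * (Pi.single i 1 : Fin n → ℝ) k) :=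
    Finset.sum_congr rfl fun i _ => by ring
  rw [e1, e2] at key
  linear_combination key

theorem isVectorRiccati_of_hasFracLinGeneralSolution (hI : IsOpen I) (hf : IsC3InState I f)
    (h : HasFracLinGeneralSolution I f) : IsVectorRiccati I f := by
  obtain ⟨A, β, γ, δ, -, h⟩ := h
  have hcont : ∀ x, ContinuousOn (fun t => f t x) I := fun x =>
    hf.continuousOn.comp (f := fun t : ℝ => (t, x)) (by fun_prop) fun t ht => ⟨ht, mem_univ _⟩
  have hcontk : ∀ x k, ContinuousOn (fun t => f t x k) I := fun x k =>
    (continuous_apply k).comp_continuousOn (hcont x)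
  -- The second difference along $e_i$ isolates the quadratic part: for a Riccati field its $i$-th
  -- component is $2c_i$.
  set c : ℝ → Fin n → ℝ := fun t i =>
    (f t (Pi.single i 1) i + f t (-Pi.single i 1) i - 2 * f t 0 i) / 2 with hc
  have hcc : ∀ i, ContinuousOn (fun t => c t i) I := fun i =>
    (((hcontk _ i).add (hcontk _ i)).sub (continuousOn_const.mul (hcontk _ i))).div_const 2
  refine ⟨fun t => f t 0, fun t => Matrix.of fun k i =>
    f t (Pi.single i 1) k - f t 0 k - c t i * (Pi.single i 1 : Fin n → ℝ) k, c,
    hcont 0, ?_, continuousOn_pi.2 hcc, ?_⟩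
  · refine continuousOn_pi.2 fun k => continuousOn_pi.2 fun i => ?_
    exact ((hcontk _ k).sub (hcontk _ k)).sub ((hcc i).mul continuousOn_const)
  · intro τ hτ ξ
    have hs := fun ξ => hf.hasDerivAt_generalSolution hI hτ ξ
    ext k
    rw [velocity_eq_of_fracLin (g := fun ξ t => generalSolution I f t τ ξ) (fun ξ => (hs ξ).1)
      (fun ξ => (hs ξ).2.2) (fun ξ => (hs ξ).2.1.mono fun t ht => h τ hτ ξ t ht)
      (c := c τ) (fun i => rfl) ξ k]
    simp only [Pi.add_apply, Pi.smul_apply, smul_eq_mul, mulVec, dotProduct, Matrix.of_apply]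
    congr 2
    exact Finset.sum_congr rfl fun i _ => mul_comm _ _

end FractionalLinear

/-! ### Fundamental matrices -/

section MatrixLinear

variable {m : Type*} [Fintype m] [DecidableEq m]

/-- Multiplication of vectors by a matrix, as a continuous linear map. -/
noncomputable def mulVecCLM : Matrix m m ℝ →ₗ[ℝ] (m → ℝ) →L[ℝ] (m → ℝ) :=
  LinearMap.toContinuousLinearMap.toLinearMap ∘ₗ Matrix.toLin'.toLinearMap

@[simp]
theorem mulVecCLM_apply (M : Matrix m m ℝ) (x : m → ℝ) : mulVecCLM M x = M *ᵥ x := rfl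

theorem continuousOn_mulVecCLM {I : Set ℝ} {M : ℝ → Matrix m m ℝ} (hM : ContinuousOn M I) :
    ContinuousOn (fun t => mulVecCLM (M t)) I :=
  (LinearMap.continuous_of_finiteDimensional (mulVecCLM (m := m))).comp_continuousOn hM

theorem exists_isFundamentalMatrix {I : Set ℝ} (hIo : IsOpen I) (hI : I.OrdConnected)
    {M : ℝ → Matrix m m ℝ} (hM : ContinuousOn M I) :
    ∃ Φ : ℝ → ℝ → Matrix m m ℝ, IsFundamentalMatrix I M Φ := by
  have h := fun (τ : ℝ) (hτ : τ ∈ I) (j : m) =>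
    exists_linear_solution hIo hI (continuousOn_mulVecCLM hM) hτ (Pi.single j 1)
  choose! x hx0 hx using h
  refine ⟨fun t τ => Matrix.of fun i j => x τ j t i, fun τ hτ => ⟨?_, fun t ht i j => ?_⟩⟩
  · ext i j
    simp [hx0 τ hτ j, Matrix.one_apply, Pi.single_apply]
  · exact hasDerivAt_pi.1 (hx τ hτ j t ht) i

theorem IsFundamentalMatrix.hasDerivAt_mulVec {I : Set ℝ} {M : ℝ → Matrix m m ℝ}
    {Φ : ℝ → ℝ → Matrix m m ℝ} (hΦ : IsFundamentalMatrix I M Φ) {τ t : ℝ} (hτ : τ ∈ I)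
    (ht : t ∈ I) (w : m → ℝ) : HasDerivAt (fun s => Φ s τ *ᵥ w) (M t *ᵥ (Φ t τ *ᵥ w)) t := by
  rw [hasDerivAt_pi, mulVec_mulVec]
  intro i
  exact HasDerivAt.fun_sum fun j _ => ((hΦ τ hτ).2 t ht i j).mul_const (w j)

/-- A kernel vector `w` of `Φ t τ` would give a solution `Φ s τ *ᵥ w` vanishing at `t`, hence also
at `τ`, where it equals `w`. -/
theorem IsFundamentalMatrix.det_ne_zero {I : Set ℝ} (hI : I.OrdConnected) {M : ℝ → Matrix m m ℝ}
    (hM : ContinuousOn M I) {Φ : ℝ → ℝ → Matrix m m ℝ} (hΦ : IsFundamentalMatrix I M Φ) {τ t : ℝ}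
    (hτ : τ ∈ I) (ht : t ∈ I) : (Φ t τ).det ≠ 0 := by
  intro h
  obtain ⟨w, hw, h⟩ := Matrix.exists_mulVec_eq_zero_iff.2 h
  have := eqOn_zero_of_linear hI (continuousOn_mulVecCLM hM)
    (fun s hs => hΦ.hasDerivAt_mulVec hτ hs w) ht h τ hτ
  rw [(hΦ τ hτ).1, one_mulVec] at this
  exact hw this

end MatrixLinear

/-! ### Linearization of the Riccati equation -/

section Riccati

variable {n : ℕ}

/-- If `(N, D)` solves the linearized system and `D` does not vanish, `N / D` solves the Riccati
equation. -/
theorem hasDerivAt_inv_smul {N : ℝ → Fin n → ℝ} {D : ℝ → ℝ} {a c : Fin n → ℝ}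
    {B : Matrix (Fin n) (Fin n) ℝ} {t : ℝ} (hN : HasDerivAt N (B *ᵥ N t + D t • a) t)
    (hD : HasDerivAt D (-(c ⬝ᵥ N t)) t) (h : D t ≠ 0) :
    HasDerivAt (fun s => (D s)⁻¹ • N s)
      (a + B *ᵥ ((D t)⁻¹ • N t) + (c ⬝ᵥ ((D t)⁻¹ • N t)) • ((D t)⁻¹ • N t)) t := by
  refine ((hD.fun_inv h).fun_smul hN).congr_deriv ?_
  ext k
  simp only [mulVec_smul, dotProduct_smul, Pi.add_apply, Pi.smul_apply, smul_eq_mul]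
  field_simp
  ring

/-- If `(N, D)` solves the linearized system, `D τ = 1`, and `x` solves the Riccati equation with
`x τ = N τ`, then `D` does not vanish. -/
theorem denominator_ne_zero {J : Set ℝ} (hJ : J.OrdConnected) {a c : ℝ → Fin n → ℝ}
    {B : ℝ → Matrix (Fin n) (Fin n) ℝ} (hB : ContinuousOn B J) (hc : ContinuousOn c J)
    {N x : ℝ → Fin n → ℝ} {D : ℝ → ℝ}
    (hN : ∀ t ∈ J, HasDerivAt N (B t *ᵥ N t + D t • a t) t)
    (hD : ∀ t ∈ J, HasDerivAt D (-(c t ⬝ᵥ N t)) t)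
    (hx : ∀ t ∈ J, HasDerivAt x (a t + B t *ᵥ x t + (c t ⬝ᵥ x t) • x t) t)
    {τ : ℝ} (hτ : τ ∈ J) (hDτ : D τ = 1) (hxτ : x τ = N τ) : ∀ t ∈ J, D t ≠ 0 := by
  have hxc : ContinuousOn x J := HasDerivAt.continuousOn hx
  have hM : ContinuousOn (fun t => B t + vecMulVec (x t) (c t)) J := by
    refine hB.add (continuousOn_pi.2 fun i => continuousOn_pi.2 fun j => ?_)
    exact (continuousOn_pi.1 hxc i).mul (continuousOn_pi.1 hc j)
  -- The defect $u = N - Dx$ satisfies $u' = (B + x c^T) u$: the terms in $a$ cancel, and $(c^T N) x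
  -- - D (c^T x) x = (c^T u) x$.
  have hu : ∀ t ∈ J, N t - D t • x t = 0 := by
    refine eqOn_zero_of_linear hJ (continuousOn_mulVecCLM hM) (fun t ht => ?_) hτ
      (by rw [hDτ, hxτ, one_smul, sub_self])
    refine ((hN t ht).fun_sub ((hD t ht).fun_smul (hx t ht))).congr_deriv ?_
    ext k
    simp only [mulVecCLM_apply, add_mulVec, vecMulVec_mulVec, mulVec_sub, mulVec_smul,
      Pi.add_apply, Pi.sub_apply, Pi.smul_apply, smul_eq_mul,
      MulOpposite.smul_eq_mul_unop, MulOpposite.unop_op]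
    ring
  intro t ht h0
  -- With $N = Dx$ the equation for $D$ becomes $D' = -(c^T x) D$, so a zero of $D$ would propagate
  -- to `τ`, where $D = 1$.
  have hcx : ContinuousOn (fun s => -(c s ⬝ᵥ x s) • (1 : ℝ →L[ℝ] ℝ)) J := by
    have h : ContinuousOn (fun s => c s ⬝ᵥ x s) J := continuousOn_finsetSum _ fun i _ =>
      (continuousOn_pi.1 hc i).mul (continuousOn_pi.1 hxc i)
    exact h.neg.smul continuousOn_const
  have := eqOn_zero_of_linear hJ hcx (x := D) (fun s hs => by
    refine (hD s hs).congr_deriv ?_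
    rw [sub_eq_zero.1 (hu s hs), dotProduct_smul]
    simp [mul_comm]) ht h0 τ hτ
  rw [hDτ] at this
  exact one_ne_zero this

variable {I : Set ℝ} {f : ℝ → (Fin n → ℝ) → (Fin n → ℝ)} {a : ℝ → (Fin n → ℝ)}
  {B : ℝ → Matrix (Fin n) (Fin n) ℝ} {c : ℝ → (Fin n → ℝ)}

theorem IsRiccatiWith.continuousOn_linearizedMatrix (hR : IsRiccatiWith I f a B c) :
    ContinuousOn (linearizedMatrix a B c) I := by
  refine continuousOn_pi.2 fun i => continuousOn_pi.2 fun j => ?_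
  rcases i with i | i <;> rcases j with j | j
  · exact continuousOn_pi.1 (continuousOn_pi.1 hR.continuousOn_B i) j
  · exact continuousOn_pi.1 hR.continuousOn_a i
  · exact (continuousOn_pi.1 hR.continuousOn_c j).neg
  · exact continuousOn_const

theorem IsFundamentalMatrix.hasDerivAt_numerator
    {Φ : ℝ → ℝ → Matrix (Fin n ⊕ Unit) (Fin n ⊕ Unit) ℝ}
    (hΦ : IsFundamentalMatrix I (linearizedMatrix a B c) Φ) {τ t : ℝ} (hτ : τ ∈ I) (ht : t ∈ I)
    (ξ : Fin n → ℝ) :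
    HasDerivAt (fun s => blockA (Φ s τ) *ᵥ ξ + blockBeta (Φ s τ))
      (B t *ᵥ (blockA (Φ t τ) *ᵥ ξ + blockBeta (Φ t τ)) +
        (blockGamma (Φ t τ) ⬝ᵥ ξ + blockDelta (Φ t τ)) • a t) t := by
  -- Numerator and denominator are the two components of $\Phi(s, \tau)$ applied to $(\xi, 1)$, the
  -- homogeneous coordinates of $\xi$.
  have h := hΦ.hasDerivAt_mulVec hτ ht (Sum.elim ξ fun _ => 1)
  rw [hasDerivAt_pi] at h ⊢
  intro i
  refine ((h (Sum.inl i)).congr_of_eventuallyEq (Eventually.of_forall fun s => ?_)).congr_deriv ?_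
  · simp [mulVec, dotProduct, blockA, blockBeta, toBlocks₁₁]
  · simp [mulVec, dotProduct, blockA, blockBeta, blockGamma, blockDelta, toBlocks₁₁,
      linearizedMatrix, mul_comm]

theorem IsFundamentalMatrix.hasDerivAt_denominator
    {Φ : ℝ → ℝ → Matrix (Fin n ⊕ Unit) (Fin n ⊕ Unit) ℝ}
    (hΦ : IsFundamentalMatrix I (linearizedMatrix a B c) Φ) {τ t : ℝ} (hτ : τ ∈ I) (ht : t ∈ I)
    (ξ : Fin n → ℝ) :
    HasDerivAt (fun s => blockGamma (Φ s τ) ⬝ᵥ ξ + blockDelta (Φ s τ))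
      (-(c t ⬝ᵥ (blockA (Φ t τ) *ᵥ ξ + blockBeta (Φ t τ)))) t := by
  have h := hasDerivAt_pi.1 (hΦ.hasDerivAt_mulVec hτ ht (Sum.elim ξ fun _ => 1)) (Sum.inr ())
  refine (h.congr_of_eventuallyEq (Eventually.of_forall fun s => ?_)).congr_deriv ?_
  · simp [mulVec, dotProduct, blockGamma, blockDelta]
  · simp [mulVec, dotProduct, blockA, blockBeta, toBlocks₁₁, linearizedMatrix]

theorem isOpen_ordConnectedComponent {S : Set ℝ} (hS : IsOpen S) (τ : ℝ) :
    IsOpen (S.ordConnectedComponent τ) := by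
  refine isOpen_iff_mem_nhds.2 fun t ht => ?_
  rw [ordConnectedComponent_eq ht]
  exact ordConnectedComponent_mem_nhds.2 (hS.mem_nhds (ordConnectedComponent_subset ht))

/-- The quotient $N/D$ is a solution on the whole component, so the maximal interval contains it. In
the other direction, $D \ne 0$ on the interval of any solution, which therefore cannot leave the
component. -/
theorem IsRiccatiWith.maximalInterval_eq (hIo : IsOpen I) (hf : LocallyUniformlyLipschitz I f)
    (hR : IsRiccatiWith I f a B c) {Φ : ℝ → ℝ → Matrix (Fin n ⊕ Unit) (Fin n ⊕ Unit) ℝ}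
    (hΦ : IsFundamentalMatrix I (linearizedMatrix a B c) Φ) {τ : ℝ} (hτ : τ ∈ I) (ξ : Fin n → ℝ) :
    maximalInterval I f τ ξ =
        Set.ordConnectedComponent
          {t | t ∈ I ∧ blockGamma (Φ t τ) ⬝ᵥ ξ + blockDelta (Φ t τ) ≠ 0} τ ∧
      ∀ t ∈ maximalInterval I f τ ξ,
        generalSolution I f t τ ξ =
          fracLin (blockA (Φ t τ)) (blockBeta (Φ t τ)) (blockGamma (Φ t τ))
            (blockDelta (Φ t τ)) ξ := by
  set N := fun s => blockA (Φ s τ) *ᵥ ξ + blockBeta (Φ s τ) with hNdef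
  set D := fun s => blockGamma (Φ s τ) ⬝ᵥ ξ + blockDelta (Φ s τ) with hDdef
  have hN : ∀ t ∈ I, HasDerivAt N (B t *ᵥ N t + D t • a t) t := fun t ht =>
    hΦ.hasDerivAt_numerator hτ ht ξ
  have hD : ∀ t ∈ I, HasDerivAt D (-(c t ⬝ᵥ N t)) t := fun t ht =>
    hΦ.hasDerivAt_denominator hτ ht ξ
  have hNτ : N τ = ξ := by
    simp only [hNdef, (hΦ τ hτ).1]
    ext i
    simp [blockA, blockBeta, ← fromBlocks_one]
  have hDτ : D τ = 1 := by
    simp only [hDdef, (hΦ τ hτ).1]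
    simp [blockGamma, blockDelta, dotProduct]
  have hSo : IsOpen {t | t ∈ I ∧ D t ≠ 0} :=
    (HasDerivAt.continuousOn hD).isOpen_inter_preimage hIo isOpen_ne
  have hsol : IsSolutionThrough I f τ ξ (ordConnectedComponent {t | t ∈ I ∧ D t ≠ 0} τ)
      fun s => (D s)⁻¹ • N s :=
    { isOpen := isOpen_ordConnectedComponent hSo τ
      ordConnected := inferInstance
      subset := ordConnectedComponent_subset.trans fun t ht => ht.1
      mem := self_mem_ordConnectedComponent.2 ⟨hτ, by rw [hDτ]; exact one_ne_zero⟩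
      initial := by rw [hDτ, hNτ, inv_one, one_smul]
      hasDerivAt := fun t ht => by
        obtain ⟨htI, htD⟩ := ordConnectedComponent_subset ht
        rw [hR.eq t htI]
        exact hasDerivAt_inv_smul (hN t htI) (hD t htI) htD }
  have heq : maximalInterval I f τ ξ = ordConnectedComponent {t | t ∈ I ∧ D t ≠ 0} τ := by
    refine Subset.antisymm ?_ hsol.subset_maximalInterval
    rintro t ⟨J, x, hx, ht⟩
    have hne := denominator_ne_zero hx.ordConnected (hR.continuousOn_B.mono hx.subset)
      (hR.continuousOn_c.mono hx.subset) (fun s hs => hN s (hx.subset hs))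
      (fun s hs => hD s (hx.subset hs))
      (fun s hs => (hx.hasDerivAt s hs).congr_deriv (hR.eq s (hx.subset hs) _)) hx.mem hDτ
      (hx.initial.trans hNτ.symm)
    exact fun s hs => have hsJ := hx.ordConnected.uIcc_subset hx.mem ht hs
      ⟨hx.subset hsJ, hne s hsJ⟩
  refine ⟨heq, fun t ht => ?_⟩
  rw [heq] at ht
  exact hsol.generalSolution_eq hf ht

theorem IsRiccatiWith.hasFracLinGeneralSolution (hIo : IsOpen I) (hI : I.OrdConnected)
    (hf : LocallyUniformlyLipschitz I f) (hR : IsRiccatiWith I f a B c) :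
    HasFracLinGeneralSolution I f := by
  have hM := hR.continuousOn_linearizedMatrix
  obtain ⟨Φ, hΦ⟩ := exists_isFundamentalMatrix hIo hI hM
  refine ⟨fun t τ => blockA (Φ t τ), fun t τ => blockBeta (Φ t τ), fun t τ => blockGamma (Φ t τ),
    fun t τ => blockDelta (Φ t τ), fun t ht τ hτ => ?_, fun τ hτ ξ t ht => ?_⟩
  -- If `γ` and `δ` both vanished, the last row of `Φ t τ` would be zero, against invertibility.
  · by_contra! h
    refine hΦ.det_ne_zero hI hM hτ ht (det_eq_zero_of_row_eq_zero (Sum.inr ()) ?_)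
    rintro (j | j)
    · exact congrFun h.1 j
    · exact h.2
  · obtain ⟨h1, h2⟩ := hR.maximalInterval_eq hIo hf hΦ hτ ξ
    refine ⟨?_, h2 t ht⟩
    rw [h1] at ht
    exact (ordConnectedComponent_subset ht).2

end Riccati

/-- First conjunct: the characterization. Second conjunct: for a vector Riccati equation the
coefficients of the fractional linear general solution are the blocks of the fundamental matrix of
the associated linear system, and `I(τ, ξ)` is the maximal subinterval of `I` containing `τ` on
which the denominator does not vanish. -/
theorem theorem6p1 (n : ℕ) (I : Set ℝ) (hIo : IsOpen I) (hI : I.OrdConnected)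
    (f : ℝ → (Fin n → ℝ) → (Fin n → ℝ)) (hf : IsC3InState I f) :
    (IsVectorRiccati I f ↔ HasFracLinGeneralSolution I f) ∧
    ∀ (a : ℝ → (Fin n → ℝ)) (B : ℝ → Matrix (Fin n) (Fin n) ℝ) (c : ℝ → (Fin n → ℝ)),
      IsRiccatiWith I f a B c →
        (∃ Φ : ℝ → ℝ → Matrix (Fin n ⊕ Unit) (Fin n ⊕ Unit) ℝ,
          IsFundamentalMatrix I (linearizedMatrix a B c) Φ) ∧
        ∀ Φ : ℝ → ℝ → Matrix (Fin n ⊕ Unit) (Fin n ⊕ Unit) ℝ,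
          IsFundamentalMatrix I (linearizedMatrix a B c) Φ →
            ∀ τ ∈ I, ∀ ξ : Fin n → ℝ,
              maximalInterval I f τ ξ =
                Set.ordConnectedComponent
                  {t | t ∈ I ∧ blockGamma (Φ t τ) ⬝ᵥ ξ + blockDelta (Φ t τ) ≠ 0} τ ∧
              ∀ t ∈ maximalInterval I f τ ξ,
                generalSolution I f t τ ξ =
                  fracLin (blockA (Φ t τ)) (blockBeta (Φ t τ)) (blockGamma (Φ t τ))
                    (blockDelta (Φ t τ)) ξ := by
  have hL := hf.locallyUniformlyLipschitz
  refine ⟨⟨?_, isVectorRiccati_of_hasFracLinGeneralSolution hIo hf⟩, fun a B c hR => ?_⟩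
  · rintro ⟨a, B, c, hR⟩
    exact hR.hasFracLinGeneralSolution hIo hI hL
  · exact ⟨exists_isFundamentalMatrix hIo hI hR.continuousOn_linearizedMatrix,
      fun Φ hΦ τ hτ ξ => hR.maximalInterval_eq hIo hL hΦ hτ ξ⟩
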